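/- **Setting.** Let $\mathcal O$ be a Dedekind domain, $\mathfrak p$ a nonzero prime ideal of $\mathcal O$ with finite residue field of cardinality $q$, and $R$ an $\mathcal O$-algebra that is a discrete valuation ring. Let $\pi\in R$ be a nonzero generator of $\mathfrak pR$ such that $R$ is $\pi$-adically complete, and let $\phi:R\to R$ be a ring endomorphism with $\phi(\pi)=\pi$ and $\phi(x)\equiv x^q \bmod \pi$ for all $x\in R$. (The condition $\phi(\pi)=\pi$ holds if $\phi$ is $\mathcal O$-linear and $\pi$ comes from a uniformizer of $\mathcal O$ at $\mathfrak p$.) Put $S=\operatorname{Spf}R$. All formal spectra are taken for the $\pi$-adic topology. A $\pi$-formal scheme is a locally ringed space over $S$ that is locally of the form $\operatorname{Spf}A$ with $A$ a $\pi$-adically complete $R$-algebra; for an $R$-algebra $B$ write $X(B)=\operatorname{Hom}_S(\operatorname{Spf}B,X)$. For $i\ge 0$ let $B^{\phi^i}$ be the ring $B$ with structure map $R\xrightarrow{\phi^i}R\to B$, and let $X^{\phi^i}(B)=X(B^{\phi^i})$. **Witt vectors.** $W_n(B)$ denotes the $R$-algebra of $\pi$-typical Witt vectors $(x_0,\dots,x_n)$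 with entries in $B$; its ghost components $$w_i:W_n(B)\to B^{\phi^i},\qquad w_i=x_0^{q^i}+\pi x_1^{q^{i-1}}+\cdots+\pi^i x_i\quad(0\le i\le n)$$ are homomorphisms of $R$-algebras. $F:W_{n+1}(B)\to W_n(B^\phi)$ is the Frobenius, with $w_i\circ F=w_{i+1}$. The map $\exp_\delta:R\to W_n(R)$ is the ring homomorphism with $w_i\circ\exp_\delta=\phi^i$. **Jet spaces and kernels.** Formal schemes over $S$ are described by their functors of points on $\pi$-adically complete $R$-algebras $B$; a morphism $Y\to Z$ over $\phi:S\to S$ is a family of maps $Y(B)\to Z(B^\phi)$ natural in $B$. Let $X$ be a $\pi$-formal scheme with a marked point $P\in X(R)$. The jet spaces are $J^nX(B)=X(W_n(B))$, with projections $u_m:J^{m+n}X\to J^mX$ induced by truncation and marked points $P^n=P\circ\operatorname{Spf}(\exp_\delta)\in J^nX(R)$. Put $$N^{[m]n}X=J^{m+n}X\times_{u_m,\,J^mX,\,P^m}S .$$ The ghost components induce $w:J^nX\to\prod_\phi^nX=X\times_S X^\phi\times_S\cdots\times_S X^{\phi^n}$. Let $\prod_{[m]n}X$ be the part of $\prod_\phi^{m+n}X$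 that consists of the points $\langle P,\dots,P,z_{m+1},\dots,z_{m+n}\rangle$, where $z_i\in X^{\phi^i}$ and the entry $P$ in place $i\le m$ is the pullback of $P$ to $X^{\phi^i}$. Then $w$ restricts to $w:N^{[m]n}X\to\prod_{[m]n}X$. **The maps.** Let $m\ge1$ and $n\ge0$. The Frobenius $\phi:J^{m+n}X\to J^{m+n-1}X$ over $\phi:S\to S$ that is induced by $F$ restricts to a morphism $$\Phi_{[m]}:N^{[m]n}X\to N^{[m-1]n}X\quad\text{over }\phi:S\to S.$$ Let $\phi_S:X^{\phi^{i}}\to X^{\phi^{i-1}}$ be the projection over $\phi:S\to S$, that is, on $B$-points the identification $X(B^{\phi^i})=X((B^\phi)^{\phi^{i-1}})$. Let $\Phi_{[m]w}:\prod_{[m]n}X\to\prod_{[m-1]n}X$ be the morphism over $\phi:S\to S$ given by $$\Phi_{[m]w}\langle \underbrace{P,\dots,P}_{m+1},z_{m+1},\dots,z_{m+n}\rangle=\langle\underbrace{\phi_S(P),\dots,\phi_S(P)}_{m},\phi_S(z_{m+1}),\dots,\phi_S(z_{m+n})\rangle .$$ **Claim.** For all $m\ge1$ and $n\ge0$, $$w\circ\Phi_{[m]}=\Phi_{[m]w}\circ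 w$$ as morphisms $N^{[m]n}X\to\prod_{[m-1]n}X$ over $\phi:S\to S$. Moreover, $\Phi_{[m]}$ is the morphism induced by the shifted Witt vectors. For an $R$-algebra homomorphism $f:A\to B$ let $W_{[m]n}(f)=W_m(A)\times_{W_m(B)}W_{m+n}(B)$, and let $N_{[m]n}(f)$ be the set of $g\in X(W_{[m]n}(f))$ whose image in $X(W_m(A))$ is the pullback of $P^m$. The second projection $W_{[m]n}(f)\to W_{m+n}(B)$ induces $\iota_m:N_{[m]n}(f)\to N^{[m]n}X(B)$. For $f:R\to B$ the structure map this is the usual ring $W_{[m]n}(B)=W_m(R)\times_{W_m(B)}W_{m+n}(B)$. Let $E_{[m]}:W_{[m]n}(f)\to W_{[m-1]n}(f^\phi)$ be the homomorphism given by $F$ on both factors, where $f^\phi$ is $f$ regarded as a homomorphism $A^\phi\to B^\phi$. Then for every $\pi$-adically complete $R$-algebra $B$, with structure map $f:R\to B$, and every $g\in N_{[m]n}(f)$, $$\Phi_{[m]}(\iota_m(g))=\iota_{m-1}\bigl(X(E_{[m]})(g)\bigr).$$ -/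

import Mathlib

open CategoryTheory AlgebraicGeometry TopologicalSpace Opposite

universe v u

/-! ## The base -/

/-- The arithmetic base: a Dedekind domain `O` with a nonzero prime ideal `𝔭` whose residue field is
finite, an `O`-algebra `R` that is a discrete valuation ring, a nonzero generator `π` of `𝔭R` such
that `R` is `π`-adically complete, and a lift of Frobenius `φ : R → R`, that is, a ring endomorphism
with `φ(π) = π` and `φ(x) ≡ x ^ q` modulo `π`, where `q = #(O/𝔭)`.
(If `π` is the image of a uniformizer of `O` at `𝔭` and `φ` is `O`-linear, then `φ(π) = π`.) -/
structure FrobeniusBase (O : Type v) (R : Type u) [CommRing O] [IsDedekindDomain O]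
    [CommRing R] [IsDomain R] [IsDiscreteValuationRing R] [Algebra O R] where
  /-- the prime `𝔭` -/
  prime : Ideal O
  isPrime : prime.IsPrime
  ne_bot : prime ≠ ⊥
  finite_residue : Finite (O ⧸ prime)
  /-- the uniformizer `π`, regarded in `R` -/
  π : R
  π_ne_zero : π ≠ 0
  span_π : Ideal.span {π} = prime.map (algebraMap O R)
  complete : IsAdicComplete (Ideal.span {π}) R
  /-- the lift of Frobenius `φ` -/
  φ : R →+* R
  φ_π : φ π = π
  φ_congr : ∀ x, φ x - x ^ Nat.card (O ⧸ prime) ∈ Ideal.span {π}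

noncomputable section

namespace FrobeniusBase

variable {O : Type v} {R : Type u} [CommRing O] [IsDedekindDomain O]
  [CommRing R] [IsDomain R] [IsDiscreteValuationRing R] [Algebra O R] (D : FrobeniusBase O R)

/-- The cardinality `q` of the residue field of `O` at `𝔭`. -/
def q : ℕ := Nat.card (O ⧸ D.prime)

/-- The image of `π` in an `R`-algebra. -/
def pi (A : Type u) [CommRing A] [Algebra R A] : A := algebraMap R A D.π

theorem exists_q : ∃ p h : ℕ, p.Prime ∧ h ≠ 0 ∧ D.q = p ^ h ∧ D.π ∣ (p : R) := by
  have := D.isPrime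
  have := D.finite_residue
  let _ : Field (O ⧸ D.prime) := (Finite.isField_of_domain (O ⧸ D.prime)).toField
  obtain ⟨p, hp⟩ := CharP.exists (O ⧸ D.prime)
  have : Fintype (O ⧸ D.prime) := Fintype.ofFinite _
  obtain ⟨n, hpr, hn⟩ := FiniteField.card (O ⧸ D.prime) p
  refine ⟨p, n, hpr, n.2.ne', ?_, ?_⟩
  · rw [q, Nat.card_eq_fintype_card, hn]
  · have h1 : (p : O) ∈ D.prime := by
      rw [← Ideal.Quotient.eq_zero_iff_mem, map_natCast]
      exact CharP.cast_eq_zero _ _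
    have h2 := Ideal.mem_map_of_mem (algebraMap O R) h1
    rw [← D.span_π, map_natCast] at h2
    exact Ideal.mem_span_singleton.mp h2

theorem pi_dvd_q (A : Type u) [CommRing A] [Algebra R A] : D.pi A ∣ (D.q : A) := by
  obtain ⟨p, h, -, hh, hq, hd⟩ := D.exists_q
  have := (map_dvd (algebraMap R A) hd)
  rw [map_natCast] at this
  rw [hq, Nat.cast_pow]
  exact this.trans (dvd_pow_self _ hh)

theorem q_ne_zero : D.q ≠ 0 := by
  obtain ⟨p, h, hp, hh, hq, hd⟩ := D.exists_q
  rw [hq]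
  exact pow_ne_zero _ hp.ne_zero

theorem pi_dvd_add_pow {A : Type u} [CommRing A] [Algebra R A] (a b : A) :
    D.pi A ∣ (a + b) ^ D.q - (a ^ D.q + b ^ D.q) := by
  obtain ⟨p, h, hp, hh, hq, hd⟩ := D.exists_q
  have := (map_dvd (algebraMap R A) hd)
  rw [map_natCast] at this
  obtain ⟨r, hr⟩ := exists_add_pow_prime_pow_eq hp a b h
  rw [hq, hr]
  refine this.trans ⟨a * b * r, ?_⟩
  ring

theorem dvd_pow_q_sub {A : Type u} [CommRing A] [Algebra R A] {a b : A} {i : ℕ}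
    (h : D.pi A ^ (i + 1) ∣ a - b) : D.pi A ^ (i + 2) ∣ a ^ D.q - b ^ D.q := by
  rw [← (Commute.all a b).geom_sum₂_mul D.q, pow_succ' _ (i + 1)]
  refine mul_dvd_mul ?_ h
  have h1 : D.pi A ∣ a - b := (dvd_pow_self _ (Nat.succ_ne_zero i)).trans h
  rw [← Ideal.mem_span_singleton, ← Ideal.Quotient.eq_zero_iff_mem] at h1 ⊢
  rw [map_sub, sub_eq_zero] at h1
  have h2 : (Ideal.Quotient.mk (Ideal.span {D.pi A})) (D.q : A) = 0 :=
    Ideal.Quotient.eq_zero_iff_mem.mpr (Ideal.mem_span_singleton.mpr (D.pi_dvd_q A))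
  rw [map_natCast] at h2
  simp only [map_sum, map_mul, map_pow, h1]
  rw [geom_sum₂_self, h2, zero_mul]

theorem dvd_pow_pow_sub {A : Type u} [CommRing A] [Algebra R A] {a b : A}
    (h : D.pi A ∣ a - b) (i : ℕ) : D.pi A ^ (i + 1) ∣ a ^ D.q ^ i - b ^ D.q ^ i := by
  induction i with
  | zero => simpa using h
  | succ i ih =>
    rw [pow_succ D.q, pow_mul, pow_mul]
    exact D.dvd_pow_q_sub ih

/-! ## Truncated `π`-typical Witt vectors -/

/-- The underlying set `B ^ (n + 1)` of the `π`-typical Witt vectors `W_n(B)` of length `n + 1`. -/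
def Witt (_ : FrobeniusBase O R) (n : ℕ) (B : Type u) : Type u := Fin (n + 1) → B

namespace Witt

variable {D} {n : ℕ} {A B C : Type u} [CommRing A] [Algebra R A] [CommRing B] [Algebra R B]
  [CommRing C] [Algebra R C]

/-- The coordinates `x_0, …, x_n`, continued by `0`. -/
def coeff (x : D.Witt n B) (j : ℕ) : B := if h : j < n + 1 then x ⟨j, h⟩ else 0

/-- The ghost components `w_i = x_0 ^ (q ^ i) + π x_1 ^ (q ^ (i - 1)) + ⋯ + π ^ i x_i`, for
`i ≤ n`. -/
def ghost (x : D.Witt n B) (i : Fin (n + 1)) : B :=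
  ∑ j ∈ Finset.range (i + 1), D.pi B ^ j * x.coeff j ^ D.q ^ ((i : ℕ) - j)

/-- The map of sets `W_n(f) : W_n(A) → W_n(B)`. -/
def mapFun (f : A →ₐ[R] B) (x : D.Witt n A) : D.Witt n B := fun i => f (x i)

theorem coeff_mapFun (f : A →ₐ[R] B) (x : D.Witt n A) (j : ℕ) :
    (mapFun f x).coeff j = f (x.coeff j) := by
  unfold coeff mapFun
  split <;> simp

theorem map_pi (f : A →ₐ[R] B) : f (D.pi A) = D.pi B := f.commutes D.π

theorem ghost_mapFun (f : A →ₐ[R] B) (x : D.Witt n A) (i : Fin (n + 1)) :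
    (mapFun f x).ghost i = f (x.ghost i) := by
  simp [ghost, coeff_mapFun, map_pi]

/-- `A` has no `π`-torsion. -/
def TorsionFree (D : FrobeniusBase O R) (A : Type u) [CommRing A] [Algebra R A] : Prop :=
  ∀ a : A, D.pi A * a = 0 → a = 0

theorem TorsionFree.pow (hA : TorsionFree D A) (k : ℕ) (a b : A)
    (h : D.pi A ^ k * a = D.pi A ^ k * b) : a = b := by
  induction k with
  | zero => simpa using h
  | succ k ih =>
    apply ih
    rw [pow_succ', mul_assoc, mul_assoc, ← sub_eq_zero, ← mul_sub] at h
    exact sub_eq_zero.mp (hA _ h)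

theorem ghost_injective (hA : TorsionFree D A) {x y : D.Witt n A}
    (h : ∀ i, x.ghost i = y.ghost i) : x = y := by
  have key : ∀ i : ℕ, ∀ hi : i < n + 1, x ⟨i, hi⟩ = y ⟨i, hi⟩ := by
    intro i
    induction i using Nat.strong_induction_on with
    | _ i ih =>
      intro hi
      have hi' := h ⟨i, hi⟩
      simp only [ghost] at hi'
      rw [Finset.sum_range_succ, Finset.sum_range_succ] at hi'
      have : ∀ j ∈ Finset.range i, D.pi A ^ j * x.coeff j ^ D.q ^ (i - j) =
          D.pi A ^ j * y.coeff j ^ D.q ^ (i - j) := by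
        intro j hj
        have hji := Finset.mem_range.mp hj
        simp only [coeff, dif_pos (hji.trans hi), ih j hji]
      rw [Finset.sum_congr rfl this] at hi'
      have h3 := add_left_cancel hi'
      simp only [Nat.sub_self, pow_zero, pow_one, coeff, dif_pos hi] at h3
      exact hA.pow _ _ _ h3
  funext i
  exact key i i.2

/-- A lift of Frobenius on an `R`-algebra fixing `π`. -/
structure IsLift (D : FrobeniusBase O R) (ψ : A →+* A) : Prop where
  map_pi : ψ (D.pi A) = D.pi A
  congr : ∀ a, D.pi A ∣ ψ a - a ^ D.q

/-- Dwork's criterion. -/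
theorem exists_ghost_iff {ψ : A →+* A} (hψ : IsLift D ψ) (z : Fin (n + 1) → A) :
    (∃ x : D.Witt n A, ∀ i, x.ghost i = z i) ↔
      ∀ (i : ℕ) (hi : i + 1 < n + 1),
        D.pi A ^ (i + 1) ∣ z ⟨i + 1, hi⟩ - ψ (z ⟨i, Nat.lt_of_succ_lt hi⟩) := by
  have key : ∀ (c : ℕ → A) (i : ℕ), D.pi A ^ (i + 1) ∣
      (∑ j ∈ Finset.range (i + 1), D.pi A ^ j * c j ^ D.q ^ (i + 1 - j)) -
        ψ (∑ j ∈ Finset.range (i + 1), D.pi A ^ j * c j ^ D.q ^ (i - j)) := by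
    intro c i
    rw [map_sum, ← Finset.sum_sub_distrib]
    refine Finset.dvd_sum fun j hj => ?_
    have hj' : j ≤ i := Nat.lt_succ_iff.mp (Finset.mem_range.mp hj)
    rw [map_mul, map_pow, map_pow, hψ.map_pi, ← mul_sub]
    obtain ⟨k, rfl⟩ := Nat.exists_eq_add_of_le hj'
    have e1 : j + k + 1 - j = 1 + k := by omega
    have e2 : j + k - j = k := by omega
    rw [e1, e2, pow_add D.q, pow_one, pow_mul, add_assoc, pow_add]
    refine mul_dvd_mul_left _ (D.dvd_pow_pow_sub ?_ k)
    rw [← dvd_neg, neg_sub]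
    exact hψ.congr _
  constructor
  · rintro ⟨x, hx⟩ i hi
    rw [← hx, ← hx]
    simp only [ghost]
    rw [Finset.sum_range_succ, add_sub_right_comm]
    exact dvd_add (key _ _) (Dvd.intro _ rfl)
  · intro hz
    have : ∀ k, k < n + 1 → ∃ c : ℕ → A, ∀ i (hi : i < n + 1), i ≤ k →
        ∑ j ∈ Finset.range (i + 1), D.pi A ^ j * c j ^ D.q ^ (i - j) = z ⟨i, hi⟩ := by
      intro k hk
      induction k with
      | zero =>
        refine ⟨fun _ => z ⟨0, hk⟩, fun i hi h0 => ?_⟩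
        obtain rfl : i = 0 := by omega
        simp
      | succ k ih =>
        obtain ⟨c, hc⟩ := ih (by omega)
        have h1 := hz k hk
        rw [← hc k (by omega) le_rfl] at h1
        obtain ⟨d, hd⟩ := dvd_sub h1 (key c k)
        have hne : ∀ i ≤ k, ∀ e : ℕ → ℕ,
            ∑ j ∈ Finset.range (i + 1), D.pi A ^ j * Function.update c (k + 1) d j ^ e j =
            ∑ j ∈ Finset.range (i + 1), D.pi A ^ j * c j ^ e j := by
          intro i hi e
          refine Finset.sum_congr rfl fun j hj => ?_
          have := Finset.mem_range.mp hj
          rw [Function.update_of_ne (by omega)]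
        refine ⟨Function.update c (k + 1) d, fun i hi hik => ?_⟩
        rcases Nat.lt_or_eq_of_le hik with h | rfl
        · rw [hne i (by omega), hc i hi (by omega)]
        · rw [Finset.sum_range_succ, hne k le_rfl]
          simp only [Function.update_self, Nat.sub_self, pow_zero, pow_one]
          rw [← hd]
          ring
    obtain ⟨c, hc⟩ := this n (by omega)
    refine ⟨fun i => c i, fun i => ?_⟩
    rw [← hc i i.2 (by omega)]
    refine Finset.sum_congr rfl fun j hj => ?_
    have h1 := Finset.mem_range.mp hj
    have h2 : j < n + 1 := by omega
    simp only [coeff, dif_pos h2]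

theorem torsionFree_base : TorsionFree D R := by
  intro a ha
  rcases mul_eq_zero.mp ha with h | h
  · exact absurd h D.π_ne_zero
  · exact h

theorem isLift_φ : IsLift D D.φ where
  map_pi := D.φ_π
  congr a := Ideal.mem_span_singleton.mp (D.φ_congr a)

theorem torsionFree_poly (σ : Type u) : TorsionFree D (MvPolynomial σ R) := by
  intro a ha
  rcases mul_eq_zero.mp ha with h | h
  · exact absurd ((map_eq_zero_iff _ (MvPolynomial.C_injective σ R)).mp h) D.π_ne_zero
  · exact h

/-- The lift of Frobenius on a polynomial ring that raises the variables to the power `q`. -/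
def polyLift (D : FrobeniusBase O R) (σ : Type u) : MvPolynomial σ R →+* MvPolynomial σ R :=
  MvPolynomial.eval₂Hom (MvPolynomial.C.comp D.φ) fun s => MvPolynomial.X s ^ D.q

theorem isLift_polyLift (σ : Type u) : IsLift D (polyLift D σ) where
  map_pi := by
    change polyLift D σ (MvPolynomial.C D.π) = MvPolynomial.C D.π
    simp [polyLift, D.φ_π]
  congr a := by
    induction a using MvPolynomial.induction_on with
    | C a =>
      have := map_dvd (MvPolynomial.C (σ := σ)) (Ideal.mem_span_singleton.mp (D.φ_congr a))
      simpa [polyLift, pi, MvPolynomial.algebraMap_eq, q] using this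
    | add a b ha hb =>
      have := dvd_sub (dvd_add ha hb) (D.pi_dvd_add_pow a b)
      convert this using 1
      rw [map_add]
      ring
    | mul_X a s ha =>
      have e : polyLift D σ (MvPolynomial.X s) = MvPolynomial.X s ^ D.q := by simp [polyLift]
      rw [map_mul, mul_pow, e, ← sub_mul]
      exact Dvd.dvd.mul_right ha _

/-- A polynomial combination of ghost vectors is a ghost vector. -/
theorem exists_binary {ψ : A →+* A} (hψ : IsLift D ψ) (x y : D.Witt n A)
    (g : A → A → A) (hg : ∀ a b, ψ (g a b) = g (ψ a) (ψ b))
    (hd : ∀ (m a b c d : A), m ∣ a - c → m ∣ b - d → m ∣ g a b - g c d) :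
    ∃ s : D.Witt n A, ∀ i, s.ghost i = g (x.ghost i) (y.ghost i) := by
  refine (exists_ghost_iff hψ (fun i => g (x.ghost i) (y.ghost i))).mpr fun i hi => ?_
  rw [hg]
  exact hd _ _ _ _ _ ((exists_ghost_iff hψ x.ghost).mp ⟨x, fun _ => rfl⟩ i hi)
    ((exists_ghost_iff hψ y.ghost).mp ⟨y, fun _ => rfl⟩ i hi)

/-- Index set of two generic Witt vectors of length `n + 1`. -/
abbrev Idx (n : ℕ) : Type u := ULift.{u} (Fin (n + 1) ⊕ Fin (n + 1))

/-- The first generic Witt vector. -/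
def genX (D : FrobeniusBase O R) (n : ℕ) : D.Witt n (MvPolynomial (Idx.{u} n) R) :=
  fun i => MvPolynomial.X ⟨Sum.inl i⟩

/-- The second generic Witt vector. -/
def genY (D : FrobeniusBase O R) (n : ℕ) : D.Witt n (MvPolynomial (Idx.{u} n) R) :=
  fun i => MvPolynomial.X ⟨Sum.inr i⟩

theorem exists_addPoly (D : FrobeniusBase O R) (n : ℕ) :
    ∃ s : D.Witt n (MvPolynomial (Idx.{u} n) R),
      ∀ i, s.ghost i = (genX D n).ghost i + (genY D n).ghost i :=
  exists_binary (isLift_polyLift _) _ _ (· + ·) (map_add _) fun m a b c d h1 h2 => by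
    have := dvd_add h1 h2
    rwa [← add_sub_add_comm] at this

theorem exists_mulPoly (D : FrobeniusBase O R) (n : ℕ) :
    ∃ s : D.Witt n (MvPolynomial (Idx.{u} n) R),
      ∀ i, s.ghost i = (genX D n).ghost i * (genY D n).ghost i :=
  exists_binary (isLift_polyLift _) _ _ (· * ·) (map_mul _) fun m a b c d h1 h2 => by
    have := dvd_add (h1.mul_right b) (h2.mul_left c)
    convert this using 1
    ring

theorem exists_negPoly (D : FrobeniusBase O R) (n : ℕ) :
    ∃ s : D.Witt n (MvPolynomial (Idx.{u} n) R), ∀ i, s.ghost i = -(genX D n).ghost i :=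
  exists_binary (isLift_polyLift _) _ (genX D n) (fun a _ => -a) (fun a _ => map_neg _ a)
    fun m a b c d h1 _ => by
      have := h1.neg_right
      convert this using 1
      ring

/-- The unique polynomials giving the addition of Witt vectors. -/
def addPoly (D : FrobeniusBase O R) (n : ℕ) : D.Witt n (MvPolynomial (Idx.{u} n) R) :=
  (exists_addPoly D n).choose

/-- The unique polynomials giving the multiplication of Witt vectors. -/
def mulPoly (D : FrobeniusBase O R) (n : ℕ) : D.Witt n (MvPolynomial (Idx.{u} n) R) :=
  (exists_mulPoly D n).choose

/-- The unique polynomials giving the additive inverse of Witt vectors. -/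
def negPoly (D : FrobeniusBase O R) (n : ℕ) : D.Witt n (MvPolynomial (Idx.{u} n) R) :=
  (exists_negPoly D n).choose

/-- Evaluation of polynomials at a pair of Witt vectors. -/
def evalAt (x y : D.Witt n B) : MvPolynomial (Idx.{u} n) R →ₐ[R] B :=
  MvPolynomial.aeval fun s => Sum.elim x y s.down

theorem evalAt_comp (f : A →ₐ[R] B) (x y : D.Witt n A) :
    f.comp (evalAt x y) = evalAt (mapFun f x) (mapFun f y) := by
  apply MvPolynomial.algHom_ext
  rintro ⟨i | i⟩ <;> simp [evalAt] <;> rfl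

theorem mapFun_genX (x y : D.Witt n B) : mapFun (evalAt x y) (genX D n) = x := by
  funext i
  simp only [mapFun, evalAt, genX, MvPolynomial.aeval_X]
  rfl

theorem mapFun_genY (x y : D.Witt n B) : mapFun (evalAt x y) (genY D n) = y := by
  funext i
  simp only [mapFun, evalAt, genY, MvPolynomial.aeval_X]
  rfl

instance : Zero (D.Witt n B) := ⟨fun _ => 0⟩
instance : One (D.Witt n B) := ⟨fun i => if i = 0 then 1 else 0⟩
instance : Add (D.Witt n B) := ⟨fun x y => mapFun (evalAt x y) (addPoly D n)⟩
instance : Mul (D.Witt n B) := ⟨fun x y => mapFun (evalAt x y) (mulPoly D n)⟩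
instance : Neg (D.Witt n B) := ⟨fun x => mapFun (evalAt x x) (negPoly D n)⟩

theorem ghost_zero (i : Fin (n + 1)) : (0 : D.Witt n B).ghost i = 0 := by
  refine Finset.sum_eq_zero fun j hj => ?_
  have : (0 : D.Witt n B).coeff j = 0 := by
    unfold coeff
    split <;> rfl
  rw [this, zero_pow (pow_ne_zero _ D.q_ne_zero), mul_zero]

theorem ghost_one (i : Fin (n + 1)) : (1 : D.Witt n B).ghost i = 1 := by
  have h0 : (1 : D.Witt n B).coeff 0 = 1 := by
    unfold coeff
    rw [dif_pos (Nat.succ_pos n)]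
    rfl
  have h1 : ∀ j, j ≠ 0 → (1 : D.Witt n B).coeff j = 0 := by
    intro j hj
    unfold coeff
    split
    · rename_i h
      have : (⟨j, h⟩ : Fin (n + 1)) ≠ 0 := by
        intro h2
        exact hj (congrArg Fin.val h2)
      exact if_neg this
    · rfl
  unfold ghost
  rw [Finset.sum_eq_single 0]
  · simp [h0]
  · intro j _ hj
    rw [h1 j hj, zero_pow (pow_ne_zero _ D.q_ne_zero), mul_zero]
  · simp

theorem ghost_add (x y : D.Witt n B) (i : Fin (n + 1)) :
    (x + y).ghost i = x.ghost i + y.ghost i := by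
  change (mapFun (evalAt x y) (addPoly D n)).ghost i = _
  rw [ghost_mapFun, addPoly, (exists_addPoly D n).choose_spec, map_add, ← ghost_mapFun,
    ← ghost_mapFun, mapFun_genX, mapFun_genY]

theorem ghost_mul (x y : D.Witt n B) (i : Fin (n + 1)) :
    (x * y).ghost i = x.ghost i * y.ghost i := by
  change (mapFun (evalAt x y) (mulPoly D n)).ghost i = _
  rw [ghost_mapFun, mulPoly, (exists_mulPoly D n).choose_spec, map_mul, ← ghost_mapFun,
    ← ghost_mapFun, mapFun_genX, mapFun_genY]

theorem ghost_neg (x : D.Witt n B) (i : Fin (n + 1)) : (-x).ghost i = -x.ghost i := by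
  change (mapFun (evalAt x x) (negPoly D n)).ghost i = _
  rw [ghost_mapFun, negPoly, (exists_negPoly D n).choose_spec, map_neg, ← ghost_mapFun,
    mapFun_genX]

theorem mapFun_comp (f : A →ₐ[R] B) (g : B →ₐ[R] C) (x : D.Witt n A) :
    mapFun g (mapFun f x) = mapFun (g.comp f) x := rfl

theorem mapFun_zero (f : A →ₐ[R] B) : mapFun f (0 : D.Witt n A) = 0 := by
  funext i
  exact map_zero f

theorem mapFun_one (f : A →ₐ[R] B) : mapFun f (1 : D.Witt n A) = 1 := by
  funext i
  change f (if i = 0 then 1 else 0) = if i = 0 then 1 else 0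
  split <;> simp

theorem mapFun_add (f : A →ₐ[R] B) (x y : D.Witt n A) :
    mapFun f (x + y) = mapFun f x + mapFun f y := by
  change mapFun f (mapFun (evalAt x y) _) = mapFun (evalAt _ _) _
  rw [mapFun_comp, evalAt_comp]

theorem mapFun_mul (f : A →ₐ[R] B) (x y : D.Witt n A) :
    mapFun f (x * y) = mapFun f x * mapFun f y := by
  change mapFun f (mapFun (evalAt x y) _) = mapFun (evalAt _ _) _
  rw [mapFun_comp, evalAt_comp]

theorem mapFun_neg (f : A →ₐ[R] B) (x : D.Witt n A) : mapFun f (-x) = -mapFun f x := by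
  change mapFun f (mapFun (evalAt x x) _) = mapFun (evalAt _ _) _
  rw [mapFun_comp, evalAt_comp]

/-- The polynomial ring over `R` on the elements of `B`, mapped onto `B`. -/
def cover (B : Type u) [CommRing B] [Algebra R B] : MvPolynomial B R →ₐ[R] B :=
  MvPolynomial.aeval id

theorem mapFun_cover_surjective (x : D.Witt n B) : ∃ y, mapFun (cover B) y = x :=
  ⟨fun i => MvPolynomial.X (x i), by
    funext i
    simp [mapFun, cover]⟩

theorem poly_ext {σ : Type u} {x y : D.Witt n (MvPolynomial σ R)}
    (h : ∀ i, x.ghost i = y.ghost i) : x = y :=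
  ghost_injective (torsionFree_poly σ) h

/-- The ring `W_n(B)`: the functorial ring structure for which the ghost components are ring
homomorphisms. -/
instance : CommRing (D.Witt n B) :=
  CommRing.ofMinimalAxioms
    (by
      intro x y z
      obtain ⟨x, rfl⟩ := mapFun_cover_surjective x
      obtain ⟨y, rfl⟩ := mapFun_cover_surjective y
      obtain ⟨z, rfl⟩ := mapFun_cover_surjective z
      simp only [← mapFun_add]
      exact congrArg _ (poly_ext fun i => by simp only [ghost_add, add_assoc]))
    (by
      intro x
      obtain ⟨x, rfl⟩ := mapFun_cover_surjective x
      rw [← mapFun_zero (cover B), ← mapFun_add]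
      exact congrArg _ (poly_ext fun i => by simp only [ghost_add, ghost_zero, zero_add]))
    (by
      intro x
      obtain ⟨x, rfl⟩ := mapFun_cover_surjective x
      rw [← mapFun_neg, ← mapFun_zero (cover B), ← mapFun_add]
      exact congrArg _ (poly_ext fun i => by
        simp only [ghost_add, ghost_neg, ghost_zero, neg_add_cancel]))
    (by
      intro x y z
      obtain ⟨x, rfl⟩ := mapFun_cover_surjective x
      obtain ⟨y, rfl⟩ := mapFun_cover_surjective y
      obtain ⟨z, rfl⟩ := mapFun_cover_surjective z
      simp only [← mapFun_mul]
      exact congrArg _ (poly_ext fun i => by simp only [ghost_mul, mul_assoc]))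
    (by
      intro x y
      obtain ⟨x, rfl⟩ := mapFun_cover_surjective x
      obtain ⟨y, rfl⟩ := mapFun_cover_surjective y
      simp only [← mapFun_mul]
      exact congrArg _ (poly_ext fun i => by simp only [ghost_mul, mul_comm]))
    (by
      intro x
      obtain ⟨x, rfl⟩ := mapFun_cover_surjective x
      rw [← mapFun_one (cover B), ← mapFun_mul]
      exact congrArg _ (poly_ext fun i => by simp only [ghost_mul, ghost_one, one_mul]))
    (by
      intro x y z
      obtain ⟨x, rfl⟩ := mapFun_cover_surjective x
      obtain ⟨y, rfl⟩ := mapFun_cover_surjective y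
      obtain ⟨z, rfl⟩ := mapFun_cover_surjective z
      simp only [← mapFun_mul, ← mapFun_add]
      exact congrArg _ (poly_ext fun i => by simp only [ghost_mul, ghost_add, mul_add]))

/-- `W_n(f)` as a ring homomorphism. -/
def mapRing (f : A →ₐ[R] B) : D.Witt n A →+* D.Witt n B where
  toFun := mapFun f
  map_zero' := mapFun_zero f
  map_one' := mapFun_one f
  map_add' := mapFun_add f
  map_mul' := mapFun_mul f

theorem exists_exp (D : FrobeniusBase O R) (n : ℕ) (r : R) :
    ∃ x : D.Witt n R, ∀ i, x.ghost i = (D.φ ^ (i : ℕ)) r := by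
  refine (exists_ghost_iff isLift_φ (fun i => (D.φ ^ (i : ℕ)) r)).mpr fun i hi => ?_
  have : (D.φ ^ (i + 1)) r = D.φ ((D.φ ^ i) r) := by
    rw [pow_succ']
    rfl
  simp [this]

/-- `exp_δ(r) ∈ W_n(R)`, the Witt vector with ghost components `r, φ(r), …, φ^n(r)`. -/
def expFun (D : FrobeniusBase O R) (n : ℕ) (r : R) : D.Witt n R := (exists_exp D n r).choose

theorem ghost_expFun (r : R) (i : Fin (n + 1)) :
    (expFun D n r).ghost i = (D.φ ^ (i : ℕ)) r := (exists_exp D n r).choose_spec i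

/-- The ring homomorphism `exp_δ : R → W_n(R)`. -/
def expRing (D : FrobeniusBase O R) (n : ℕ) : R →+* D.Witt n R where
  toFun := expFun D n
  map_zero' := ghost_injective torsionFree_base fun i => by simp [ghost_expFun, ghost_zero]
  map_one' := ghost_injective torsionFree_base fun i => by simp [ghost_expFun, ghost_one]
  map_add' x y := ghost_injective torsionFree_base fun i => by simp [ghost_expFun, ghost_add]
  map_mul' x y := ghost_injective torsionFree_base fun i => by simp [ghost_expFun, ghost_mul]

/-- The `R`-algebra structure of `W_n(B)`. -/
instance : Algebra R (D.Witt n B) :=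
  ((mapRing (Algebra.ofId R B)).comp (expRing D n)).toAlgebra

theorem algebraMap_eq (r : R) :
    algebraMap R (D.Witt n B) r = mapFun (Algebra.ofId R B) (expFun D n r) := rfl

/-- `W_n(f) : W_n(A) → W_n(B)`. -/
def map (f : A →ₐ[R] B) : D.Witt n A →ₐ[R] D.Witt n B where
  __ := mapRing f
  commutes' r := by
    change mapFun f (mapFun _ _) = mapFun _ _
    rw [mapFun_comp]
    congr 1
    exact Subsingleton.elim _ _

/-- The universal map `exp_δ : R → W_n(R)`. -/
def exp (D : FrobeniusBase O R) (n : ℕ) : R →ₐ[R] D.Witt n R where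
  __ := expRing D n
  commutes' r := by
    refine (funext fun i => ?_ : _ = mapFun (Algebra.ofId R R) (expFun D n r))
    rfl

end Witt

/-! ## Twists of `R`-algebras -/

/-- The `R`-algebra `B^{φ^i}`: the ring `B` with structure map `R → R → B`, the first map being
`φ^i`. -/
def Twist (_ : FrobeniusBase O R) (_ : ℕ) (B : Type u) : Type u := B

namespace Twist

variable {D} {A B C : Type u} [CommRing A] [Algebra R A] [CommRing B] [Algebra R B]

instance (i : ℕ) : CommRing (D.Twist i B) := inferInstanceAs (CommRing B)

instance (i : ℕ) : Algebra R (D.Twist i B) :=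
  RingHom.toAlgebra (S := D.Twist i B) ((algebraMap R B).comp (D.φ ^ i))

theorem algebraMap_eq (i : ℕ) (r : R) :
    algebraMap R (D.Twist i B) r = algebraMap R B ((D.φ ^ i) r) := rfl

/-- A homomorphism `f : A → B` as a homomorphism `A^{φ^i} → B^{φ^i}`. -/
def map (i : ℕ) (f : A →ₐ[R] B) : D.Twist i A →ₐ[R] D.Twist i B where
  __ := (f : A →+* B)
  commutes' _ := f.commutes _

/-- The identity map `B^{φ^(i+1)} → (B^φ)^{φ^i}`. -/
def shift (D : FrobeniusBase O R) (i : ℕ) (B : Type u) [CommRing B] [Algebra R B] :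
    D.Twist (i + 1) B →ₐ[R] D.Twist i (D.Twist 1 B) where
  __ := RingHom.id B
  commutes' r := by
    change algebraMap R B ((D.φ ^ (i + 1)) r) = algebraMap R B ((D.φ ^ 1) ((D.φ ^ i) r))
    rw [pow_succ', pow_one]
    rfl

theorem φ_pow_π (i : ℕ) : (D.φ ^ i) D.π = D.π := by
  induction i with
  | zero => rfl
  | succ i ih =>
    rw [pow_succ']
    change D.φ ((D.φ ^ i) D.π) = _
    rw [ih, D.φ_π]

theorem pi_eq (i : ℕ) : D.pi (D.Twist i B) = D.pi B :=
  congrArg (algebraMap R B) (φ_pow_π i)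

end Twist

namespace Witt

variable {D} {n : ℕ} {A B C : Type u} [CommRing A] [Algebra R A] [CommRing B] [Algebra R B]
  [CommRing C] [Algebra R C]

/-- The `i`-th component `W_n(B) → B^{φ^i}` of the ghost map `W_n(B) → B × B^φ × ⋯ × B^{φ^n}`. -/
def ghostHom (D : FrobeniusBase O R) (n : ℕ) (B : Type u) [CommRing B] [Algebra R B]
    (i : Fin (n + 1)) : D.Witt n B →ₐ[R] D.Twist i B where
  toFun x := x.ghost i
  map_zero' := ghost_zero (B := B) i
  map_one' := ghost_one (B := B) i
  map_add' x y := ghost_add x y i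
  map_mul' x y := ghost_mul x y i
  commutes' r := by
    rw [algebraMap_eq, ghost_mapFun, ghost_expFun]
    rfl

/-- The truncation of Witt vectors, on sets. -/
def truncFun {m : ℕ} (h : m ≤ n) (x : D.Witt n B) : D.Witt m B :=
  fun i => x (Fin.castLE (Nat.succ_le_succ h) i)

theorem ghost_truncFun {m : ℕ} (h : m ≤ n) (x : D.Witt n B) (i : Fin (m + 1)) :
    (truncFun h x).ghost i = x.ghost (Fin.castLE (Nat.succ_le_succ h) i) := by
  refine Finset.sum_congr rfl fun j hj => ?_
  have h1 : j < (i : ℕ) + 1 := Finset.mem_range.mp hj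
  have h2 : j < m + 1 := by omega
  have h3 : j < n + 1 := h2.trans_le (Nat.succ_le_succ h)
  have : (truncFun h x).coeff j = x.coeff j := by
    simp only [coeff, dif_pos h2, dif_pos h3]
    rfl
  rw [this]
  rfl

theorem truncFun_mapFun {m : ℕ} (h : m ≤ n) (f : A →ₐ[R] B) (x : D.Witt n A) :
    truncFun h (mapFun f x) = mapFun f (truncFun h x) := rfl

/-- The truncation map `T : W_n(B) → W_m(B)`, `(x_0, …, x_n) ↦ (x_0, …, x_m)`, for `m ≤ n`. -/
def trunc (D : FrobeniusBase O R) {m n : ℕ} (h : m ≤ n) (B : Type u) [CommRing B] [Algebra R B] :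
    D.Witt n B →ₐ[R] D.Witt m B where
  toFun := truncFun h
  map_zero' := rfl
  map_one' := by
    funext i
    change (if Fin.castLE (Nat.succ_le_succ h) i = 0 then (1 : B) else 0) = if i = 0 then 1 else 0
    exact if_congr (by rw [Fin.ext_iff, Fin.ext_iff]; rfl) rfl rfl
  map_add' x y := by
    obtain ⟨x, rfl⟩ := mapFun_cover_surjective x
    obtain ⟨y, rfl⟩ := mapFun_cover_surjective y
    simp only [← mapFun_add, truncFun_mapFun]
    exact congrArg _ (poly_ext fun i => by simp only [ghost_add, ghost_truncFun])
  map_mul' x y := by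
    obtain ⟨x, rfl⟩ := mapFun_cover_surjective x
    obtain ⟨y, rfl⟩ := mapFun_cover_surjective y
    simp only [← mapFun_mul, truncFun_mapFun]
    exact congrArg _ (poly_ext fun i => by simp only [ghost_mul, ghost_truncFun])
  commutes' r := by
    change truncFun h (mapFun _ _) = mapFun _ _
    rw [truncFun_mapFun]
    exact congrArg _ (ghost_injective torsionFree_base fun i =>
      (ghost_truncFun h _ i).trans ((ghost_expFun r _).trans (ghost_expFun r i).symm))

/-! ### The Witt vector Frobenius -/

theorem exists_frobPoly (D : FrobeniusBase O R) (n : ℕ) :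
    ∃ s : D.Witt n (MvPolynomial (Idx.{u} (n + 1)) R),
      ∀ i, s.ghost i = (genX D (n + 1)).ghost i.succ := by
  refine (exists_ghost_iff (isLift_polyLift _)
    (fun i => (genX D (n + 1)).ghost i.succ)).mpr fun i hi => ?_
  have := (exists_ghost_iff (isLift_polyLift _) (genX D (n + 1)).ghost).mp ⟨_, fun _ => rfl⟩
    (i + 1) (by omega)
  exact (pow_dvd_pow _ (Nat.le_succ _)).trans this

/-- The unique polynomials `F_0, …, F_n` in `x_0, …, x_{n+1}` giving the Frobenius. -/
def frobPoly (D : FrobeniusBase O R) (n : ℕ) : D.Witt n (MvPolynomial (Idx.{u} (n + 1)) R) :=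
  (exists_frobPoly D n).choose

/-- The Frobenius on Witt vectors, on sets. -/
def frobFun (x : D.Witt (n + 1) B) : D.Witt n (D.Twist 1 B) :=
  fun i => evalAt x x (frobPoly D n i)

theorem ghost_twist (x : D.Witt n B) (i : Fin (n + 1)) :
    ghost (D := D) (n := n) (B := D.Twist 1 B) x i = x.ghost i := by
  have := Twist.pi_eq (D := D) (B := B) 1
  unfold ghost
  rw [this]
  rfl

theorem ghost_frobFun (x : D.Witt (n + 1) B) (i : Fin (n + 1)) :
    (frobFun x).ghost i = x.ghost i.succ := by
  refine (ghost_twist (mapFun (evalAt x x) (frobPoly D n)) i).trans ?_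
  rw [ghost_mapFun, frobPoly, (exists_frobPoly D n).choose_spec, ← ghost_mapFun, mapFun_genX]

theorem frobFun_mapFun (f : A →ₐ[R] B) (x : D.Witt (n + 1) A) :
    frobFun (mapFun f x) = mapFun (Twist.map 1 f) (frobFun x) := by
  funext i
  change evalAt (mapFun f x) (mapFun f x) (frobPoly D n i) = f (evalAt x x (frobPoly D n i))
  rw [← evalAt_comp]
  rfl

theorem torsionFree_twist (hA : TorsionFree D A) : TorsionFree D (D.Twist 1 A) := by
  intro a ha
  rw [Twist.pi_eq] at ha
  exact hA a ha

theorem twist_poly_ext {σ : Type u} {x y : D.Witt n (D.Twist 1 (MvPolynomial σ R))}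
    (h : ∀ i, x.ghost i = y.ghost i) : x = y :=
  ghost_injective (torsionFree_twist (torsionFree_poly σ)) h

/-- The Frobenius `F : W_{n+1}(B) → W_n(B^φ)`, which is the left shift on ghost components. -/
def frob (D : FrobeniusBase O R) (n : ℕ) (B : Type u) [CommRing B] [Algebra R B] :
    D.Witt (n + 1) B →ₐ[R] D.Witt n (D.Twist 1 B) where
  toFun := frobFun
  map_zero' := by
    rw [← mapFun_zero (cover B), frobFun_mapFun, ← mapFun_zero (Twist.map 1 (cover B))]
    exact congrArg _ (twist_poly_ext fun i => by
      rw [ghost_frobFun, ghost_zero, ghost_zero]; rfl)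
  map_one' := by
    rw [← mapFun_one (cover B), frobFun_mapFun, ← mapFun_one (Twist.map 1 (cover B))]
    exact congrArg _ (twist_poly_ext fun i => by
      rw [ghost_frobFun, ghost_one, ghost_one]; rfl)
  map_add' x y := by
    obtain ⟨x, rfl⟩ := mapFun_cover_surjective x
    obtain ⟨y, rfl⟩ := mapFun_cover_surjective y
    simp only [← mapFun_add, frobFun_mapFun]
    exact congrArg _ (twist_poly_ext fun i => by
      rw [ghost_add, ghost_frobFun, ghost_frobFun, ghost_frobFun, ghost_add]; rfl)
  map_mul' x y := by
    obtain ⟨x, rfl⟩ := mapFun_cover_surjective x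
    obtain ⟨y, rfl⟩ := mapFun_cover_surjective y
    simp only [← mapFun_mul, frobFun_mapFun]
    exact congrArg _ (twist_poly_ext fun i => by
      rw [ghost_mul, ghost_frobFun, ghost_frobFun, ghost_frobFun, ghost_mul]; rfl)
  commutes' r := by
    have h1 : frobFun (expFun D (n + 1) r) = mapFun (Algebra.ofId R (D.Twist 1 R)) (expFun D n r) :=
      ghost_injective (torsionFree_twist torsionFree_base) fun i => by
        rw [ghost_frobFun, ghost_mapFun, ghost_expFun, ghost_expFun]
        change _ = (D.φ ^ 1) ((D.φ ^ (i : ℕ)) r)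
        rw [Fin.val_succ, pow_succ', pow_one]
        rfl
    change frobFun (mapFun (Algebra.ofId R B) (expFun D (n + 1) r)) =
      mapFun (Algebra.ofId R (D.Twist 1 B)) (expFun D n r)
    rw [frobFun_mapFun, h1, mapFun_comp]
    exact congrArg (fun f : R →ₐ[R] D.Twist 1 B => mapFun f (expFun D n r)) (Subsingleton.elim _ _)

theorem map_apply (f : A →ₐ[R] B) (x : D.Witt n A) : map f x = mapFun f x := rfl

theorem map_comp (f : A →ₐ[R] B) (g : B →ₐ[R] C) :
    (map g).comp (map f) = map (D := D) (n := n) (g.comp f) := rfl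

theorem trunc_comp_map {m : ℕ} (h : m ≤ n) (f : A →ₐ[R] B) :
    (trunc D h B).comp (map f) = (map f).comp (trunc D h A) := rfl

theorem frob_comp_map (f : A →ₐ[R] B) :
    (frob D n B).comp (map f) = (map (Twist.map 1 f)).comp (frob D n A) :=
  AlgHom.ext fun x => frobFun_mapFun f x

theorem trunc_comp_frob {m : ℕ} (h : m ≤ n) (h' : m + 1 ≤ n + 1) :
    (trunc D h (D.Twist 1 B)).comp (frob D n B) = (frob D m B).comp (trunc D h' B) := by
  refine AlgHom.ext fun x => ?_
  change truncFun h (frobFun x) = frobFun (truncFun h' x)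
  obtain ⟨x, rfl⟩ := mapFun_cover_surjective x
  rw [truncFun_mapFun, frobFun_mapFun, frobFun_mapFun, truncFun_mapFun]
  exact congrArg _ (twist_poly_ext fun i => by
    rw [ghost_truncFun, ghost_frobFun, ghost_frobFun, ghost_truncFun]; rfl)

end Witt

/-! ## Shifted Witt vectors -/

/-- The shifted Witt vectors `W_m(A) ×_{W_m(B)} W_{m+n}(B)` of an `R`-algebra homomorphism
`f : A → B`. For the structure map `R → B` this is the ring `W_{[m]n}(B)`, whose underlying set is
`R^{m+1} × B^n`; for the structure map regarded as a homomorphism `R^φ → B^φ` it is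
`W_{[m]n}(B^φ)`. -/
def ShiftedWitt (D : FrobeniusBase O R) (m n : ℕ) {A B : Type u} [CommRing A] [Algebra R A]
    [CommRing B] [Algebra R B] (f : A →ₐ[R] B) : Subalgebra R (D.Witt m A × D.Witt (n + m) B) :=
  AlgHom.equalizer ((Witt.map f).comp (AlgHom.fst R _ _))
    ((Witt.trunc D (Nat.le_add_left m n) B).comp (AlgHom.snd R _ _))

namespace ShiftedWitt

variable {D} {m n : ℕ} {A B : Type u} [CommRing A] [Algebra R A] [CommRing B] [Algebra R B]

/-- The projection `W_{[m]n}(B) → W_m(R)`, with kernel the Witt vectors supported in `B^n`. -/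
def toBase (D : FrobeniusBase O R) (m n : ℕ) (f : A →ₐ[R] B) :
    D.ShiftedWitt m n f →ₐ[R] D.Witt m A :=
  (AlgHom.fst R _ _).comp (D.ShiftedWitt m n f).val

/-- The natural map `I_{[m]n} : W_{[m]n}(B) → W_{m+n}(B)`. -/
def I (D : FrobeniusBase O R) (m n : ℕ) (f : A →ₐ[R] B) :
    D.ShiftedWitt m n f →ₐ[R] D.Witt (n + m) B :=
  (AlgHom.snd R _ _).comp (D.ShiftedWitt m n f).val

theorem map_comp_toBase (f : A →ₐ[R] B) :
    (Witt.map f).comp (toBase D m n f) =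
      (Witt.trunc D (Nat.le_add_left m n) B).comp (I D m n f) :=
  AlgHom.ext fun x => x.2

/-- The homomorphism `E_{[m+1]} : W_{[m+1]n}(B) → W_{[m]n}(B^φ)`, given on coordinates by the
Frobenius polynomials. -/
def E (D : FrobeniusBase O R) (m n : ℕ) (f : A →ₐ[R] B) :
    D.ShiftedWitt (m + 1) n f →ₐ[R] D.ShiftedWitt m n (Twist.map (D := D) 1 f) :=
  AlgHom.codRestrict
    (((Witt.frob D m A).comp (toBase D (m + 1) n f)).prod
      ((Witt.frob D (n + m) B).comp (I D (m + 1) n f))) _ fun x => by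
    have h1 := DFunLike.congr_fun (Witt.frob_comp_map (D := D) (n := m) f)
      (toBase D (m + 1) n f x)
    have h2 := DFunLike.congr_fun (map_comp_toBase (D := D) (m := m + 1) (n := n) f) x
    have h3 := DFunLike.congr_fun (Witt.trunc_comp_frob (D := D) (B := B)
      (Nat.le_add_left m n) (Nat.le_add_left (m + 1) n)) (I D (m + 1) n f x)
    exact h1.symm.trans ((congrArg (Witt.frob D m B) h2).trans h3.symm)

theorem toBase_comp_E (f : A →ₐ[R] B) :
    (toBase D m n (Twist.map 1 f)).comp (E D m n f) =
      (Witt.frob D m A).comp (toBase D (m + 1) n f) := rfl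

theorem I_comp_E (f : A →ₐ[R] B) :
    (I D m n (Twist.map 1 f)).comp (E D m n f) =
      (Witt.frob D (n + m) B).comp (I D (m + 1) n f) := rfl

end ShiftedWitt

/-! ## `π`-formal schemes -/

section Spf

variable {D} {A B C : Type u} [CommRing A] [Algebra R A] [CommRing B] [Algebra R B]
  [CommRing C] [Algebra R C]

/-- The system `Spec(B/π) → Spec(B/π²) → ⋯` of locally ringed spaces. -/
def spfDiagram (D : FrobeniusBase O R) (B : Type u) [CommRing B] [Algebra R B] :
    ℕ ⥤ LocallyRingedSpace.{u} where
  obj k := (Spec (.of (B ⧸ Ideal.span {D.pi B} ^ (k + 1)))).toLocallyRingedSpace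
  map {k l} h := (Spec.map (CommRingCat.ofHom (Ideal.Quotient.factor
    (Ideal.pow_le_pow_right (Nat.succ_le_succ (leOfHom h)))))).toLRSHom
  map_id k := by
    have : Ideal.Quotient.factor (le_refl (Ideal.span {D.pi B} ^ (k + 1))) = RingHom.id _ := by
      ext; rfl
    rw [this, CommRingCat.ofHom_id, Spec.map_id]
    rfl
  map_comp {k l j} h h' := by
    rw [← Scheme.Hom.comp_toLRSHom, ← Spec.map_comp, ← CommRingCat.ofHom_comp]
    congr 3
    ext; rfl

theorem span_pow_le_comap (f : A →ₐ[R] B) (k : ℕ) :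
    Ideal.span {D.pi A} ^ k ≤ (Ideal.span {D.pi B} ^ k).comap (f : A →+* B) := by
  rw [Ideal.span_singleton_pow, Ideal.span_singleton_pow, Ideal.span_singleton_le_iff_mem,
    Ideal.mem_comap]
  change f (D.pi A ^ k) ∈ _
  rw [map_pow, Witt.map_pi]
  exact Ideal.mem_span_singleton_self _

/-- The morphisms `Spec(B/π^k) → Spec(A/π^k)` induced by `f : A → B`. -/
def spfDiagramMap (D : FrobeniusBase O R) (f : A →ₐ[R] B) : D.spfDiagram B ⟶ D.spfDiagram A where
  app k := (Spec.map (CommRingCat.ofHom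
    (Ideal.quotientMap _ (f : A →+* B) (span_pow_le_comap (D := D) f (k + 1))))).toLRSHom
  naturality k l h := by
    dsimp only [spfDiagram]
    rw [← Scheme.Hom.comp_toLRSHom, ← Scheme.Hom.comp_toLRSHom, ← Spec.map_comp, ← Spec.map_comp,
      ← CommRingCat.ofHom_comp, ← CommRingCat.ofHom_comp]
    congr 3
    ext; rfl

theorem spfDiagramMap_id : D.spfDiagramMap (AlgHom.id R A) = 𝟙 _ := by
  ext k : 2
  have : Ideal.quotientMap _ ((AlgHom.id R A : A →ₐ[R] A) : A →+* A)
      (span_pow_le_comap (D := D) (AlgHom.id R A) (k + 1)) = RingHom.id _ := by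
    ext; rfl
  dsimp only [spfDiagramMap]
  rw [this, CommRingCat.ofHom_id, Spec.map_id]
  rfl

theorem spfDiagramMap_comp (f : A →ₐ[R] B) (g : B →ₐ[R] C) :
    D.spfDiagramMap (g.comp f) = D.spfDiagramMap g ≫ D.spfDiagramMap f := by
  refine NatTrans.ext (funext fun k => ?_)
  have h : CommRingCat.ofHom (Ideal.quotientMap _ ((g.comp f : A →ₐ[R] C) : A →+* C)
        (span_pow_le_comap (D := D) (g.comp f) (k + 1))) =
      CommRingCat.ofHom (Ideal.quotientMap _ (f : A →+* B)
        (span_pow_le_comap (D := D) f (k + 1))) ≫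
      CommRingCat.ofHom (Ideal.quotientMap _ (g : B →+* C)
        (span_pow_le_comap (D := D) g (k + 1))) := by
    rw [← CommRingCat.ofHom_comp]
    congr 1
    ext; rfl
  exact (congrArg Scheme.Hom.toLRSHom ((congrArg Spec.map h).trans (Spec.map_comp _ _))).trans
    (Scheme.Hom.comp_toLRSHom _ _)

/-- The formal spectrum `Spf B` for the `π`-adic topology of an `R`-algebra `B`, as a locally ringed
space: the colimit of the schemes `Spec(B/π^k)`. Its points are the prime ideals of `B` that contain
`π`, and its structure sheaf is the limit of the structure sheaves of the `Spec(B/π^k)`. -/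
abbrev Spf (D : FrobeniusBase O R) (B : Type u) [CommRing B] [Algebra R B] : LocallyRingedSpace.{u} :=
  Limits.colimit (D.spfDiagram B)

/-- The morphism `Spf B → Spf A` induced by `f : A → B`. -/
def spfMap (D : FrobeniusBase O R) (f : A →ₐ[R] B) : D.Spf B ⟶ D.Spf A :=
  Limits.colimMap (D.spfDiagramMap f)

theorem spfMap_id : D.spfMap (AlgHom.id R A) = 𝟙 _ := by
  refine Limits.colimit.hom_ext fun k => ?_
  rw [spfMap, Limits.ι_colimMap, spfDiagramMap_id]
  exact (Category.id_comp _).trans (Category.comp_id _).symm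

theorem spfMap_comp (f : A →ₐ[R] B) (g : B →ₐ[R] C) :
    D.spfMap (g.comp f) = D.spfMap g ≫ D.spfMap f := by
  refine Limits.colimit.hom_ext fun k => ?_
  rw [spfMap, spfMap, spfMap, Limits.ι_colimMap, spfDiagramMap_comp, Limits.ι_colimMap_assoc,
    Limits.ι_colimMap]
  exact Category.assoc _ _ _

/-- `Spf B` over `S = Spf R`. -/
def SpfOver (D : FrobeniusBase O R) (B : Type u) [CommRing B] [Algebra R B] : Over (D.Spf R) :=
  Over.mk (D.spfMap (Algebra.ofId R B))

/-- The morphism `Spf B → Spf A` over `S` induced by `f : A → B`. -/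
def spfOverMap (D : FrobeniusBase O R) (f : A →ₐ[R] B) : D.SpfOver B ⟶ D.SpfOver A :=
  Over.homMk (D.spfMap f) (by
    change D.spfMap f ≫ D.spfMap (Algebra.ofId R A) = D.spfMap (Algebra.ofId R B)
    rw [← spfMap_comp]
    congr 1
    exact Subsingleton.elim _ _)

theorem spfOverMap_id : D.spfOverMap (AlgHom.id R A) = 𝟙 _ :=
  Over.OverMorphism.ext spfMap_id

theorem spfOverMap_comp (f : A →ₐ[R] B) (g : B →ₐ[R] C) :
    D.spfOverMap (g.comp f) = D.spfOverMap g ≫ D.spfOverMap f :=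
  Over.OverMorphism.ext (spfMap_comp f g)

/-- A `π`-formal scheme over `S = Spf R`: a locally ringed space over `S` in which every point has
an open neighbourhood isomorphic over `S` to `Spf A` for a `π`-adically complete `R`-algebra `A`. -/
structure PiFormalScheme (D : FrobeniusBase O R) where
  /-- the locally ringed space with its structure morphism to `S` -/
  toOver : Over (D.Spf R)
  locally_affine : ∀ x : toOver.left, ∃ (U : Opens toOver.left) (A : CommAlgCat.{u} R),
    x ∈ U ∧ IsAdicComplete (Ideal.span {D.pi A}) A ∧
      Nonempty (Over.mk (toOver.left.ofRestrict U.isOpenEmbedding ≫ toOver.hom) ≅ D.SpfOver A)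

/-- The `R`-algebras that are `π`-adically complete. -/
def isComplete (D : FrobeniusBase O R) : ObjectProperty (CommAlgCat.{u} R) :=
  fun B => IsAdicComplete (Ideal.span {D.pi B}) B

/-- The category of `π`-adically complete `R`-algebras. -/
abbrev CompleteAlg (D : FrobeniusBase O R) := D.isComplete.FullSubcategory

/-- The functor `B ↦ B^φ`. For functors `Y`, `Z` of points over `S`, a morphism `Y → Z` over
`φ : S → S` is a natural transformation from `Y` to `B ↦ Z(B^φ)`. -/
def twist (D : FrobeniusBase O R) : D.CompleteAlg ⥤ D.CompleteAlg where
  obj B := ⟨.of R (D.Twist 1 B.obj), by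
    have h := B.property
    change IsAdicComplete (Ideal.span {D.pi (D.Twist 1 B.obj)}) (D.Twist 1 B.obj)
    rw [Twist.pi_eq]
    exact h⟩
  map f := ObjectProperty.homMk (CommAlgCat.ofHom (Twist.map 1 f.hom.hom))

end Spf

/-! ## Jet spaces, kernels and ghost maps -/

namespace PiFormalScheme

variable {D} (X : D.PiFormalScheme) {A B C : Type u} [CommRing A] [Algebra R A] [CommRing B]
  [Algebra R B] [CommRing C] [Algebra R C]

/-- `X(B) = Hom_S(Spf B, X)`. -/
def Points (B : Type u) [CommRing B] [Algebra R B] : Type u := D.SpfOver B ⟶ X.toOver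

/-- `X(f) : X(A) → X(B)` for `f : A → B`. -/
def map (f : A →ₐ[R] B) (x : X.Points A) : X.Points B := D.spfOverMap f ≫ x

theorem map_id (x : X.Points A) : X.map (AlgHom.id R A) x = x := by
  unfold map
  rw [spfOverMap_id]
  exact Category.id_comp _

theorem map_map (f : A →ₐ[R] B) (g : B →ₐ[R] C) (x : X.Points A) :
    X.map g (X.map f x) = X.map (g.comp f) x := by
  unfold map
  rw [spfOverMap_comp]
  exact (Category.assoc _ _ _).symm

/-- The marked point `P` as a point of `X` with values in an `R`-algebra. -/
def const (P : X.Points R) (B : Type u) [CommRing B] [Algebra R B] : X.Points B :=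
  X.map (Algebra.ofId R B) P

theorem map_const (P : X.Points R) (f : A →ₐ[R] B) : X.map f (X.const P A) = X.const P B := by
  unfold const
  rw [map_map]
  congr 1
  exact Subsingleton.elim _ _

theorem map_comm {A' : Type u} [CommRing A'] [Algebra R A'] {f : A →ₐ[R] B} {g : B →ₐ[R] C}
    {f' : A →ₐ[R] A'} {g' : A' →ₐ[R] C} (h : g.comp f = g'.comp f') (x : X.Points A) :
    X.map g (X.map f x) = X.map g' (X.map f' x) := by
  rw [map_map, map_map, h]

/-- The marked point `P^n ∈ J^nX(R) = X(W_n(R))`, the composite of `P` with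
`exp_δ : R → W_n(R)`. -/
def jetPoint (P : X.Points R) (n : ℕ) : X.Points (D.Witt n R) := X.map (Witt.exp D n) P

/-- The pullback of `P^n ∈ X(W_n(R))` to `X(W_n(B))`. -/
def jetPointAt (P : X.Points R) (n : ℕ) (B : Type u) [CommRing B] [Algebra R B] :
    X.Points (D.Witt n B) :=
  X.map (Witt.map (Algebra.ofId R B)) (X.jetPoint P n)

theorem jetPointAt_eq (P : X.Points R) (n : ℕ) (B : Type u) [CommRing B] [Algebra R B] :
    X.jetPointAt P n B = X.const P (D.Witt n B) := by
  unfold jetPointAt jetPoint const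
  rw [map_map]
  rfl

theorem hom_ext_types {α β : Type u} {f g : α ⟶ β} (h : ∀ x, f x = g x) : f = g :=
  ConcreteCategory.hom_ext _ _ h

/-- The jet space functor `J^nX`, `J^nX(B) = X(W_n(B))`. -/
def jet (n : ℕ) : D.CompleteAlg ⥤ Type u where
  obj B := X.Points (D.Witt n B.obj)
  map f := ↾fun g => X.map (Witt.map f.hom.hom) g
  map_id _ := hom_ext_types fun g => X.map_id g
  map_comp f f' := hom_ext_types fun g =>
    (X.map_map (Witt.map f.hom.hom) (Witt.map f'.hom.hom) g).symm

/-- The product `X × X^φ × ⋯ × X^{φ^n}` over `S`, where `X^{φ^i}(B) = X(B^{φ^i})`. -/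
def ghostProd (n : ℕ) : D.CompleteAlg ⥤ Type u where
  obj B := ∀ i : Fin (n + 1), X.Points (D.Twist i B.obj)
  map f := ↾fun z i => X.map (Twist.map i f.hom.hom) (z i)
  map_id _ := hom_ext_types fun z => funext fun i => X.map_id (z i)
  map_comp f f' := hom_ext_types fun z => funext fun i =>
    (X.map_map (Twist.map i f.hom.hom) (Twist.map i f'.hom.hom) (z i)).symm

/-- The ghost map `w : J^nX → X × X^φ × ⋯ × X^{φ^n}`. -/
def ghost (n : ℕ) : X.jet n ⟶ X.ghostProd n where
  app B := ↾fun g i => X.map (Witt.ghostHom D n B.obj i) g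
  naturality A B f := hom_ext_types fun g => funext fun i =>
    X.map_comm (f := Witt.map f.hom.hom) (g := Witt.ghostHom D n B.obj i)
      (f' := Witt.ghostHom D n A.obj i) (g' := Twist.map i f.hom.hom)
      (AlgHom.ext fun x => Witt.ghost_mapFun f.hom.hom x i) g

/-- The morphism `φ : J^{n+1}X → J^nX` over `φ : S → S` induced by `F : W_{n+1}(B) → W_n(B^φ)`. -/
def frob (n : ℕ) : X.jet (n + 1) ⟶ D.twist ⋙ X.jet n where
  app B := ↾fun g => X.map (Witt.frob D n B.obj) g
  naturality _ _ f := hom_ext_types fun g =>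
    X.map_comm (Witt.frob_comp_map f.hom.hom) g

/-- The `B`-points of the kernel `N^{[m]n}X = J^{m+n}X ×_{J^mX} S` of the projection
`u_m : J^{m+n}X → J^mX` at the marked point `P^m : S → J^mX`. Since `S(B)` is a single point, these
are the `g ∈ J^{m+n}X(B)` for which `u_m(g)` is the pullback of `P^m`. -/
def KernelPoints (P : X.Points R) (m n : ℕ) (B : Type u) [CommRing B] [Algebra R B] : Type u :=
  {g : X.Points (D.Witt (n + m) B) //
    X.map (Witt.trunc D (Nat.le_add_left m n) B) g = X.jetPointAt P m B}

/-- The kernel `N^{[m]n}X`. -/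
def kernel (P : X.Points R) (m n : ℕ) : D.CompleteAlg ⥤ Type u where
  obj B := X.KernelPoints P m n B.obj
  map f := ↾fun g => ⟨X.map (Witt.map f.hom.hom) g.1, by
    refine (X.map_comm (Witt.trunc_comp_map _ f.hom.hom) g.1).trans ?_
    rw [g.2, jetPointAt_eq, jetPointAt_eq, map_const]⟩
  map_id _ := hom_ext_types fun g => Subtype.ext (X.map_id g.1)
  map_comp f f' := hom_ext_types fun g => Subtype.ext
    (X.map_map (Witt.map f.hom.hom) (Witt.map f'.hom.hom) g.1).symm

/-- The ghost product `∏_{[m]n}X`, of points `⟨P, …, P, z_{m+1}, …, z_{m+n}⟩` with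
`z_i ∈ X^{φ^i}`. The `P` at the place `i ≤ m` is the pullback of the marked point to a point of
`X^{φ^i}`, that is, the composite `Spf B^{φ^i} → S → X`, with `Spf B → S` followed by `φ^i` as the
first map. -/
def ghostProdMarked (P : X.Points R) (m n : ℕ) : D.CompleteAlg ⥤ Type u where
  obj B := {z : ∀ i : Fin (n + m + 1), X.Points (D.Twist i B.obj) //
    ∀ i : Fin (n + m + 1), (i : ℕ) ≤ m → z i = X.const P (D.Twist i B.obj)}
  map f := ↾fun z => ⟨fun i => X.map (Twist.map i f.hom.hom) (z.1 i), fun i hi =>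
    (congrArg (X.map (Twist.map i f.hom.hom)) (z.2 i hi)).trans (X.map_const P _)⟩
  map_id _ := hom_ext_types fun z => Subtype.ext (funext fun i => X.map_id (z.1 i))
  map_comp f f' := hom_ext_types fun z => Subtype.ext (funext fun i =>
    (X.map_map (Twist.map i f.hom.hom) (Twist.map i f'.hom.hom) (z.1 i)).symm)

/-- The ghost map `w : N^{[m]n}X → ∏_{[m]n}X`, the restriction of `w` on `J^{m+n}X`. -/
def ghostKernel (P : X.Points R) (m n : ℕ) : X.kernel P m n ⟶ X.ghostProdMarked P m n where
  app B := ↾fun g => ⟨(X.ghost (n + m)).app B g.1, fun i hi => by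
    have h : Witt.ghostHom D (n + m) B.obj i =
        (Witt.ghostHom D m B.obj ⟨i, Nat.lt_succ_of_le hi⟩).comp
          (Witt.trunc D (Nat.le_add_left m n) B.obj) := AlgHom.ext fun x =>
      (Witt.ghost_truncFun (Nat.le_add_left m n) x ⟨i, Nat.lt_succ_of_le hi⟩).symm
    change X.map (Witt.ghostHom D (n + m) B.obj i) g.1 = _
    rw [h, ← map_map, g.2, jetPointAt_eq, map_const]⟩
  naturality A B f := hom_ext_types fun g => Subtype.ext (funext fun i =>
    X.map_comm (f := Witt.map f.hom.hom) (g := Witt.ghostHom D (n + m) B.obj i)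
      (f' := Witt.ghostHom D (n + m) A.obj i) (g' := Twist.map i f.hom.hom)
      (AlgHom.ext fun x => Witt.ghost_mapFun f.hom.hom x i) g.1)

/-- `Φ_[m+1]` on `B`-points, `N^{[m+1]n}X(B) → N^{[m]n}X(B^φ)`: the map of fibre products
`J^{m+1+n}X ×_{J^{m+1}X} S → J^{m+n}X ×_{J^mX} S` given by `φ`, that is, by the Frobenius
polynomials on coordinates. -/
def PhiFun (P : X.Points R) (m n : ℕ) {B : Type u} [CommRing B] [Algebra R B]
    (g : X.KernelPoints P (m + 1) n B) : X.KernelPoints P m n (D.Twist 1 B) :=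
  ⟨X.map (Witt.frob D (n + m) B) g.1, by
    refine (X.map_comm (Witt.trunc_comp_frob (Nat.le_add_left m n)
      (Nat.le_add_left (m + 1) n)) g.1).trans ?_
    refine (congrArg (X.map (Witt.frob D m B)) g.2).trans ?_
    rw [jetPointAt_eq, jetPointAt_eq, map_const]⟩

/-- The morphism `Φ_[m+1] : N^{[m+1]n}X → N^{[m]n}X` over `φ : S → S`. -/
def Phi (P : X.Points R) (m n : ℕ) : X.kernel P (m + 1) n ⟶ D.twist ⋙ X.kernel P m n where
  app B := ↾fun g => X.PhiFun (B := B.obj) P m n g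
  naturality _ _ f := hom_ext_types fun g =>
    Subtype.ext (X.map_comm (Witt.frob_comp_map f.hom.hom) g.1)

/-- `φ_S : X^{φ^(i+1)} → X^{φ^i}` over `φ : S → S`: on `B`-points, the identification of
`X^{φ^(i+1)}(B) = X(B^{φ^(i+1)})` with `X^{φ^i}(B^φ) = X((B^φ)^{φ^i})`. -/
def phiS (i : ℕ) {B : Type u} [CommRing B] [Algebra R B] (x : X.Points (D.Twist (i + 1) B)) :
    X.Points (D.Twist i (D.Twist 1 B)) :=
  X.map (Twist.shift D i B) x

/-- The morphism `Φ_{[m+1]w} : ∏_{[m+1]n}X → ∏_{[m]n}X` over `φ : S → S`,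
`⟨P, …, P, z_{m+2}, …, z_{m+1+n}⟩ ↦ ⟨φ_S(P), …, φ_S(P), φ_S(z_{m+2}), …, φ_S(z_{m+1+n})⟩`, with
`m + 2` entries `P` on the left and `m + 1` entries `φ_S(P)` on the right. -/
def PhiGhost (P : X.Points R) (m n : ℕ) :
    X.ghostProdMarked P (m + 1) n ⟶ D.twist ⋙ X.ghostProdMarked P m n where
  app B := ↾fun z => ⟨fun i : Fin (n + m + 1) => X.phiS (B := B.obj) i (z.1 i.succ), fun i hi =>
    (congrArg (X.phiS (B := B.obj) i) (z.2 i.succ (Nat.succ_le_succ hi))).trans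
      (X.map_const P (Twist.shift D i B.obj))⟩
  naturality A B f := hom_ext_types fun z => Subtype.ext (funext fun i =>
    X.map_comm (f := Twist.map (i + 1) f.hom.hom) (g := Twist.shift D i B.obj)
      (f' := Twist.shift D i A.obj) (g' := Twist.map i (Twist.map 1 f.hom.hom))
      (AlgHom.ext fun _ => rfl) (z.1 i.succ))

/-! ### Points with values in shifted Witt vectors -/

/-- The set `{g ∈ X(W_{[m]n}(B)) : g ∘ i_m = P^m}`, where `i_m : Spf W_m(R) → Spf W_{[m]n}(B)`, for
the structure map `R → B`; in general, the analogue for `f : A → B`. -/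
def ShiftedPoints (P : X.Points R) (m n : ℕ) (f : A →ₐ[R] B) : Type u :=
  {g : X.Points (D.ShiftedWitt m n f) //
    X.map (ShiftedWitt.toBase D m n f) g = X.jetPointAt P m A}

/-- The map on points with values in shifted Witt vectors induced by
`E_{[m+1]} : W_{[m+1]n}(B) → W_{[m]n}(B^φ)`. -/
def shiftedPhi (P : X.Points R) (m n : ℕ) (f : A →ₐ[R] B) (g : X.ShiftedPoints P (m + 1) n f) :
    X.ShiftedPoints P m n (Twist.map (D := D) 1 f) :=
  ⟨X.map (ShiftedWitt.E D m n f) g.1, by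
    rw [map_map, ShiftedWitt.toBase_comp_E, ← map_map, g.2, jetPointAt_eq, jetPointAt_eq,
      map_const]⟩

/-- The map to `N^{[m]n}X(B)` induced by `I_{[m]n} : W_{[m]n}(B) → W_{m+n}(B)`. -/
def ofShifted (P : X.Points R) (m n : ℕ) (f : A →ₐ[R] B)
    (g : X.ShiftedPoints P m n f) : X.KernelPoints P m n B :=
  ⟨X.map (ShiftedWitt.I D m n f) g.1, by
    rw [map_map, ← ShiftedWitt.map_comp_toBase, ← map_map, g.2, jetPointAt_eq, jetPointAt_eq,
      map_const]⟩

end PiFormalScheme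

end FrobeniusBase

end

/-! Functoriality of `X` turns a commuting square of `R`-algebras into a commuting square of sets of
points. The square for `w` and `Φ_{[m]}` comes from `w_i ∘ F = w_{i+1}`, and the one for shifted
Witt vectors from `F` being the second component of `E_{[m]}`. -/

namespace FrobeniusBase

variable {O : Type v} {R : Type u} [CommRing O] [IsDedekindDomain O] [CommRing R] [IsDomain R]
  [IsDiscreteValuationRing R] [Algebra O R] {D : FrobeniusBase O R}
  {A B : Type u} [CommRing A] [Algebra R A] [CommRing B] [Algebra R B]

theorem Witt.ghostHom_comp_frob {n : ℕ} (i : Fin (n + 1)) :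
    (ghostHom D n (D.Twist 1 B) i).comp (frob D n B) =
      (Twist.shift D i B).comp (ghostHom D (n + 1) B i.succ) :=
  AlgHom.ext fun x => ghost_frobFun x i

namespace PiFormalScheme

variable (X : D.PiFormalScheme)

theorem map_ghostHom_map_frob {n : ℕ} (x : X.Points (D.Witt (n + 1) B)) (i : Fin (n + 1)) :
    X.map (Witt.ghostHom D n (D.Twist 1 B) i) (X.map (Witt.frob D n B) x) =
      X.phiS i (X.map (Witt.ghostHom D (n + 1) B i.succ) x) :=
  X.map_comm (Witt.ghostHom_comp_frob i) x

theorem map_frob_map_I {m n : ℕ} {f : A →ₐ[R] B} (x : X.Points (D.ShiftedWitt (m + 1) n f)) :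
    X.map (Witt.frob D (n + m) B) (X.map (ShiftedWitt.I D (m + 1) n f) x) =
      X.map (ShiftedWitt.I D m n (Twist.map (D := D) 1 f)) (X.map (ShiftedWitt.E D m n f) x) :=
  X.map_comm (ShiftedWitt.I_comp_E (D := D) (m := m) (n := n) f).symm x

theorem PhiFun_ofShifted (P : X.Points R) {m n : ℕ} {f : A →ₐ[R] B}
    (g : X.ShiftedPoints P (m + 1) n f) :
    X.PhiFun P m n (X.ofShifted P (m + 1) n f g) =
      X.ofShifted P m n (Twist.map 1 f) (X.shiftedPhi P m n f g) :=
  Subtype.ext (X.map_frob_map_I g.1)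

end PiFormalScheme

end FrobeniusBase

theorem mainTheorem6_general {O : Type v} {R : Type u} [CommRing O] [IsDedekindDomain O]
    [CommRing R] [IsDomain R] [IsDiscreteValuationRing R] [Algebra O R] (D : FrobeniusBase O R)
    (X : D.PiFormalScheme) (P : X.Points R) (m n : ℕ) {A B : Type u} [CommRing A] [Algebra R A]
    [CommRing B] [Algebra R B] (f : A →ₐ[R] B) :
    (∀ (g : X.KernelPoints P (m + 1) n B) (i : Fin (n + m + 1)),
        X.map (FrobeniusBase.Witt.ghostHom D (n + m) (D.Twist 1 B) i) (X.PhiFun P m n g).1 =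
          X.phiS i (X.map (FrobeniusBase.Witt.ghostHom D (n + m + 1) B i.succ) g.1)) ∧
      ∀ g : X.ShiftedPoints P (m + 1) n f,
        X.PhiFun P m n (X.ofShifted P (m + 1) n f g) =
          X.ofShifted P m n (FrobeniusBase.Twist.map 1 f) (X.shiftedPhi P m n f g) :=
  ⟨fun g => X.map_ghostHom_map_frob g.1, X.PhiFun_ofShifted P⟩

theorem mainTheorem6 {O : Type v} {R : Type u} [CommRing O] [IsDedekindDomain O] [CommRing R]
    [IsDomain R] [IsDiscreteValuationRing R] [Algebra O R] (D : FrobeniusBase O R)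
    (X : D.PiFormalScheme) (P : X.Points R) (m n : ℕ) :
    X.Phi P m n ≫ Functor.whiskerLeft D.twist (X.ghostKernel P m n) =
        X.ghostKernel P (m + 1) n ≫ X.PhiGhost P m n ∧
      ∀ (B : D.CompleteAlg) (g : X.ShiftedPoints P (m + 1) n (Algebra.ofId R B.obj)),
        (X.Phi P m n).app B (X.ofShifted P (m + 1) n (Algebra.ofId R B.obj) g) =
          X.ofShifted P m n (FrobeniusBase.Twist.map 1 (Algebra.ofId R B.obj))
            (X.shiftedPhi P m n (Algebra.ofId R B.obj) g) := by
  have pointwise (B : D.CompleteAlg) := mainTheorem6_general D X P m n (Algebra.ofId R B.obj)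
  exact ⟨NatTrans.ext (funext fun B => FrobeniusBase.PiFormalScheme.hom_ext_types fun g =>
    Subtype.ext (funext ((pointwise B).1 g))), fun B => (pointwise B).2⟩
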